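/- Let $\psi$ be the Laplace exponent of a spectrally negative Lévy process $X$ with non-monotone paths, i.e. $E(e^{\lambda X_t})=e^{t\psi(\lambda)}$ and $$\psi(\lambda)=-\mu\lambda+\frac{\sigma^2}{2}\lambda^2+\int_{(-\infty,0)}\bigl(e^{\lambda x}-1-\lambda x\mathbf 1_{|x|<1}\bigr)\,\Pi(dx),\qquad \lambda\ge 0,$$ where $\mu,\sigma\in\mathbb R$ and $\Pi$ is a measure on $(-\infty,0)$ with $\int(1\wedge x^2)\,\Pi(dx)<\infty$. Let $\psi'(0+)\in[-\infty,\infty)$ be its right derivative at $0$. For $q\ge 0$ put $\psi^{(q)}=\psi-q$ and let $\Phi(q)=\sup\{\lambda\ge0:\psi(\lambda)=q\}$ be the largest root of $\psi^{(q)}$ on $[0,\infty)$. Let $W^{(q)}$ be the $q$-scale function of $\psi$: it is nonnegative, vanishes on $(-\infty,0)$, is right continuous on $[0,\infty)$, and satisfies $\int_0^\infty e^{-\lambda x}W^{(q)}(x)\,dx=1/(\psi(\lambda)-q)$ for $\lambda>\Phi(q)$. For a Laplace exponent $f$ of the above class write $W_f$ for its scale function (the case $q=0$ of this definition). For $\delta,\beta\ge0$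 let $$\mathcal T_{\delta,\beta}\psi^{(q)}(u)=\frac{u+\beta-\delta}{u+\beta}\,\psi^{(q)}(u+\beta)-\frac{\beta-\delta}{\beta}\,\psi^{(q)}(\beta),\qquad u\ge0,$$ where for $\beta=0$ it is required that $\psi'(0+)=q=0$; in that case the expression is read by continuity at $u=0$, and its last term is $0$. (i) Let $q,\beta\ge0$, with $\psi'(0+)=q=0$ if $\beta=0$. Then $\mathcal T_{\beta,\beta}\psi^{(q)}$ is the Laplace exponent of a spectrally negative Lévy process with non-monotone paths (without killing), and it has exactly one scale function, given for $x\ge0$ by $$W_{\mathcal T_{\beta,\beta}\psi^{(q)}}(x)=e^{-\beta x}W^{(q)}(x)+\beta\int_0^xe^{-\beta y}W^{(q)}(y)\,dy .$$ (ii) Suppose that $\psi'(0+)\le0$. Then, for all $q,\delta\ge0$, $\mathcal T_{\delta,\Phi(q)}\psi^{(q)}$ is the Laplace exponent of a spectrally negative Lévy process with non-monotone paths (without killing), and it has exactly one scale function, given for $x\ge0$ by $$W_{\mathcal T_{\delta,\Phi(q)}\psi^{(q)}}(x)=e^{-\Phi(q)x}\Bigl(W^{(q)}(x)+\delta e^{\delta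 x}\int_0^xe^{-\delta y}W^{(q)}(y)\,dy\Bigr).$$ In particular, for $q=0$ this is the formula for $\mathcal T_{\delta,\Phi(0)}\psi$ in terms of $\Phi(0)$ and $W=W^{(0)}$. -/

import Mathlib

open MeasureTheory Set Filter Topology

/-- `(μ, σ, ν)` is the Lévy triplet of a spectrally negative Lévy process with non-monotone paths:
`ν` is a measure carried by `(-∞, 0)` that integrates `1 ∧ x²`.  Decreasing paths occur exactly when
`σ = 0`, `∫_{(-1,0)} |x| ν(dx) < ∞` and the drift `-μ - ∫_{(-1,0)} x ν(dx)` is at most `0`; increasing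
paths occur only for a pure linear drift (`σ = 0`, `ν = 0`).  Both are excluded. -/
structure IsSpectrallyNegativeTriplet (μ σ : ℝ) (ν : Measure ℝ) : Prop where
  carried : ν (Ici 0) = 0
  integrates : ∫⁻ x, ENNReal.ofReal (min 1 (x ^ 2)) ∂ν < ⊤
  not_monotone : σ ≠ 0 ∨ ¬ IntegrableOn (fun x : ℝ => x) (Ioo (-1) 0) ν ∨
    (ν ≠ 0 ∧ 0 < -μ - ∫ x in Ioo (-1 : ℝ) 0, x ∂ν)

/-- The Lévy–Khintchine formula for the Laplace exponent at `t ≥ 0`, that is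
`log E (exp (t X₁))` for the spectrally negative Lévy process `X` with triplet `(μ, σ, ν)`. -/
noncomputable def levyKhintchine (μ σ : ℝ) (ν : Measure ℝ) (t : ℝ) : ℝ :=
  -μ * t + σ ^ 2 / 2 * t ^ 2 +
    ∫ x, (Real.exp (t * x) - 1 - t * x * (Ioo (-1 : ℝ) 1).indicator 1 x) ∂ν

/-- `ψ`, on `[0, ∞)`, is the Laplace exponent of a spectrally negative Lévy process
(without killing, and with non-monotone paths). -/
def IsLaplaceExponent (ψ : ℝ → ℝ) : Prop :=
  ∃ (μ σ : ℝ) (ν : Measure ℝ), IsSpectrallyNegativeTriplet μ σ ν ∧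
    ∀ t : ℝ, 0 ≤ t → ψ t = levyKhintchine μ σ ν t

/-- `Φ(q)`, the largest root of `ψ = q` on `[0, ∞)`. -/
noncomputable def largestRoot (ψ : ℝ → ℝ) (q : ℝ) : ℝ :=
  sSup {t : ℝ | 0 ≤ t ∧ ψ t = q}

/-- `W` is the `q`-scale function attached to the exponent `ψ`: nonnegative, zero on `(-∞, 0)`,
right continuous on `[0, ∞)`, with Laplace transform `1 / (ψ - q)` on `(Φ(q), ∞)`. -/
structure IsScaleFunction (ψ : ℝ → ℝ) (q : ℝ) (W : ℝ → ℝ) : Prop where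
  nonneg : ∀ x, 0 ≤ W x
  eq_zero : ∀ x, x < 0 → W x = 0
  right_continuous : ∀ x, 0 ≤ x → ContinuousWithinAt W (Ici x) x
  integrable : ∀ t, largestRoot ψ q < t →
    IntegrableOn (fun x => Real.exp (-t * x) * W x) (Ioi 0)
  laplace : ∀ t, largestRoot ψ q < t →
    ∫ x in Ioi (0 : ℝ), Real.exp (-t * x) * W x = 1 / (ψ t - q)

/-- `ψ'(0+) = m`, where `m = -∞` is allowed. -/
def HasRightDerivAtZero (ψ : ℝ → ℝ) (m : EReal) : Prop :=
  Tendsto (fun t : ℝ => (((ψ t - ψ 0) / t : ℝ) : EReal)) (𝓝[>] 0) (𝓝 m)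

/-- The killed exponent `ψ^{(q)} = ψ - q`. -/
def killedExponent (ψ : ℝ → ℝ) (q : ℝ) : ℝ → ℝ := fun u => ψ u - q

/-- The transform `T_{δ,β} f`, for `u ≥ 0`.  It is applied with `β > 0`, or with `β = 0` to an `f`
with `f(0) = 0` and `f'(0+) = 0`; in the second case the terms `-δ f(u) / u` at `u = 0` and
`((β - δ) / β) f(β)` at `β = 0` are limits equal to `0`, the value that division by zero gives here. -/
noncomputable def expTransform (δ β : ℝ) (f : ℝ → ℝ) : ℝ → ℝ := fun u =>
  (u + β - δ) / (u + β) * f (u + β) - (β - δ) / β * f β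

/-! Write `f = ψ - q`. For `u > 0` the transform is `(f(u+β) - f(β)) - δ (f(u+β)/(u+β) - f(β)/β)`.
The first bracket is an Esscher transform, with Lévy measure `e^{βx} ν(dx)`. For the second, `ψ(t)/t
= -μ + σ² t/2 - ∫ c_t dν`, where `c_t` is `compensatedPrimitive t`, and `c_{u+β}(x) - c_β(x) = ∫_x^0
e^{βz}(e^{uz} - 1) dz`. By Fubini this integrates against `ν` to `∫ e^{βz}(e^{uz} - 1) ν((-∞,z))
dz`, and `-q/t` acts like an extra mass `q` of `ν` at `-∞`. Hence the transform is a Lévy–Khintchine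
exponent with the same `σ` and Lévy measure `e^{βz}(ν + δκ)(dz)`, where `κ(dz) = (ν((-∞,z)) + q) dz`
on `(-∞,0)` (`levyKhintchine_tiltedSum`).

Non-monotonicity is read off from growth: it forces the exponent to tend to infinity, and conversely
growth together with `σ ≠ 0` or `ν ≠ 0` gives it back (`not_monotone_of_tendsto`). Growth passes
through the transform because `(u+β-δ)/(u+β)` tends to 1.

In (i) `δ = β` and in (ii) `f(β) = 0`, so the constant term of the transform vanishes and its
reciprocal at `t` is `(1 + δ/(t+β-δ)) / f(t+β)`. This is the Laplace transform of the stated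
function, the factor `1/(t+β-δ)` coming from a convolution. Uniqueness follows from injectivity of
the Laplace transform and right continuity. -/

/-! ### The exponential primitive and its compensation -/

/-- The integral of `z ↦ exp (t z)` over `[x, 0]`. -/
noncomputable def expPrimitive (t x : ℝ) : ℝ := ∫ z in x..0, Real.exp (t * z)

theorem intervalIntegrable_exp_mul (t a b : ℝ) :
    IntervalIntegrable (fun z : ℝ => Real.exp (t * z)) volume a b :=
  (by fun_prop : Continuous fun z : ℝ => Real.exp (t * z)).intervalIntegrable a b

/-- Valid at `t = 0` as well, so the integral form extends `(1 - e^{tx})/t` continuously to `t = 0`.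
-/
theorem mul_expPrimitive (t x : ℝ) : t * expPrimitive t x = 1 - Real.exp (t * x) := by
  rw [expPrimitive, intervalIntegral.mul_integral_comp_mul_left, integral_exp]
  simp

theorem expPrimitive_eq_div {t : ℝ} (ht : t ≠ 0) (x : ℝ) :
    expPrimitive t x = (1 - Real.exp (t * x)) / t := by
  rw [← mul_expPrimitive, mul_div_cancel_left₀ _ ht]

theorem expPrimitive_zero_left (x : ℝ) : expPrimitive 0 x = -x := by
  simp [expPrimitive]

theorem expPrimitive_nonneg (t : ℝ) {x : ℝ} (hx : x ≤ 0) : 0 ≤ expPrimitive t x :=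
  intervalIntegral.integral_nonneg hx fun _ _ => (Real.exp_pos _).le

theorem expPrimitive_anti {x : ℝ} (hx : x ≤ 0) {s t : ℝ} (hst : s ≤ t) :
    expPrimitive t x ≤ expPrimitive s x := by
  refine intervalIntegral.integral_mono_on hx (intervalIntegrable_exp_mul _ _ _)
    (intervalIntegrable_exp_mul _ _ _) fun z hz => Real.exp_le_exp.2 ?_
  exact mul_le_mul_of_nonpos_right hst hz.2

theorem expPrimitive_le_neg {t x : ℝ} (ht : 0 ≤ t) (hx : x ≤ 0) : expPrimitive t x ≤ -x := by
  simpa [expPrimitive_zero_left] using expPrimitive_anti hx ht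

theorem expPrimitive_le_inv {t : ℝ} (ht : 0 < t) (x : ℝ) : expPrimitive t x ≤ t⁻¹ := by
  rw [expPrimitive_eq_div ht.ne', div_eq_mul_inv]
  have := Real.exp_pos (t * x)
  have := inv_pos.2 ht
  nlinarith

/-- Integrate `1 + tz ≤ e^{tz}`. The quadratic error is what makes the compensated primitive
integrable near 0. -/
theorem neg_sub_le_expPrimitive (t : ℝ) {x : ℝ} (hx : x ≤ 0) :
    -x - t * x ^ 2 / 2 ≤ expPrimitive t x := by
  have h : ∫ z in x..0, (1 + t * z) = -x - t * x ^ 2 / 2 := by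
    rw [intervalIntegral.integral_add (by simp) (by apply Continuous.intervalIntegrable; fun_prop),
      intervalIntegral.integral_const_mul, integral_id]
    simp
    ring
  rw [← h]
  refine intervalIntegral.integral_mono_on hx (by apply Continuous.intervalIntegrable; fun_prop)
    (intervalIntegrable_exp_mul _ _ _) fun z _ => ?_
  linarith [Real.add_one_le_exp (t * z)]

theorem continuous_expPrimitive_right (t : ℝ) : Continuous (expPrimitive t) := by
  rcases eq_or_ne t 0 with rfl | ht
  · simp only [funext expPrimitive_zero_left]
    fun_prop
  · simp only [funext (expPrimitive_eq_div ht)]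
    fun_prop

theorem continuous_expPrimitive_left (x : ℝ) : Continuous fun t => expPrimitive t x := by
  refine intervalIntegral.continuous_parametric_intervalIntegral_of_continuous' ?_ x 0
  simp only [Function.uncurry_def]
  fun_prop

/-- The compensated primitive: `-t` times it is the Lévy–Khintchine integrand. -/
noncomputable def compensatedPrimitive (t x : ℝ) : ℝ :=
  expPrimitive t x + x * (Ioo (-1 : ℝ) 1).indicator 1 x

theorem levyIntegrand_eq (t x : ℝ) :
    Real.exp (t * x) - 1 - t * x * (Ioo (-1 : ℝ) 1).indicator 1 x =
      -t * compensatedPrimitive t x := by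
  unfold compensatedPrimitive
  linear_combination mul_expPrimitive t x

theorem measurable_compensatedPrimitive (t : ℝ) : Measurable (compensatedPrimitive t) := by
  have h1 := (continuous_expPrimitive_right t).measurable
  have h2 : Measurable ((Ioo (-1 : ℝ) 1).indicator (1 : ℝ → ℝ)) :=
    measurable_one.indicator measurableSet_Ioo
  exact h1.add (measurable_id.mul h2)

theorem compensatedPrimitive_of_mem {x : ℝ} (hx : x ∈ Ioo (-1 : ℝ) 0) (t : ℝ) :
    compensatedPrimitive t x = expPrimitive t x + x := by
  have : x ∈ Ioo (-1 : ℝ) 1 := ⟨hx.1, hx.2.trans one_pos⟩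
  simp [compensatedPrimitive, this]

theorem compensatedPrimitive_of_le {x : ℝ} (hx : x ≤ -1) (t : ℝ) :
    compensatedPrimitive t x = expPrimitive t x := by
  have : x ∉ Ioo (-1 : ℝ) 1 := fun h => by linarith [h.1]
  simp [compensatedPrimitive, this]

theorem compensatedPrimitive_anti {x : ℝ} (hx : x ≤ 0) {s t : ℝ} (hst : s ≤ t) :
    compensatedPrimitive t x ≤ compensatedPrimitive s x :=
  add_le_add_left (expPrimitive_anti hx hst) _

theorem min_one_sq_of_mem {x : ℝ} (hx : x ∈ Ioo (-1 : ℝ) 0) : min 1 (x ^ 2) = x ^ 2 :=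
  min_eq_right (by nlinarith [hx.1, hx.2])

theorem min_one_sq_of_le {x : ℝ} (hx : x ≤ -1) : min 1 (x ^ 2) = 1 :=
  min_eq_left (by nlinarith)

theorem abs_compensatedPrimitive_le_of_mem {x : ℝ} (hx : x ∈ Ioo (-1 : ℝ) 0) {t : ℝ}
    (ht : 0 ≤ t) : |compensatedPrimitive t x| ≤ t / 2 * min 1 (x ^ 2) := by
  rw [compensatedPrimitive_of_mem hx, min_one_sq_of_mem hx, abs_le]
  have h1 := expPrimitive_le_neg ht hx.2.le
  have h2 := neg_sub_le_expPrimitive t hx.2.le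
  constructor
  · linarith
  · have : 0 ≤ t / 2 * x ^ 2 := by positivity
    linarith

/-- The term `t⁻¹` controls the large jumps, where nothing is compensated. It blows up as `t → 0`,
so integrability at `t = 0` needs a separate argument. -/
theorem abs_compensatedPrimitive_le {x : ℝ} (hx : x < 0) {t : ℝ} (ht : 0 < t) :
    |compensatedPrimitive t x| ≤ (t / 2 + t⁻¹) * min 1 (x ^ 2) := by
  have hm : 0 ≤ min 1 (x ^ 2) := le_min zero_le_one (sq_nonneg x)
  rcases lt_or_ge (-1) x with h | h
  · refine (abs_compensatedPrimitive_le_of_mem ⟨h, hx⟩ ht.le).trans ?_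
    exact mul_le_mul_of_nonneg_right (le_add_of_nonneg_right (by positivity)) hm
  · rw [compensatedPrimitive_of_le h, min_one_sq_of_le h, mul_one,
      abs_of_nonneg (expPrimitive_nonneg t hx.le)]
    exact (expPrimitive_le_inv ht x).trans (le_add_of_nonneg_left (by positivity))

/-- The factor `t` absorbs `t⁻¹`: the bound is locally uniform down to `t = 0` and serves as a
dominating function. -/
theorem abs_mul_compensatedPrimitive_le {x : ℝ} (hx : x < 0) {t : ℝ} (ht : 0 ≤ t) :
    |t * compensatedPrimitive t x| ≤ (t ^ 2 / 2 + 1) * min 1 (x ^ 2) := by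
  rcases ht.eq_or_lt with rfl | ht
  · simp only [zero_mul, abs_zero]
    positivity
  · rw [abs_mul, abs_of_pos ht]
    refine (mul_le_mul_of_nonneg_left (abs_compensatedPrimitive_le hx ht) ht.le).trans_eq ?_
    field_simp

/-! ### The slope of the exponent -/

/-- The slope `ψ(t) / t` of the Lévy–Khintchine exponent. -/
noncomputable def levySlope (μ σ : ℝ) (ν : Measure ℝ) (t : ℝ) : ℝ :=
  -μ + σ ^ 2 / 2 * t - ∫ x, compensatedPrimitive t x ∂ν

theorem levyKhintchine_eq_mul_levySlope (μ σ : ℝ) (ν : Measure ℝ) (t : ℝ) :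
    levyKhintchine μ σ ν t = t * levySlope μ σ ν t := by
  simp only [levyKhintchine, levySlope, levyIntegrand_eq, integral_const_mul]
  ring

theorem levyKhintchine_zero (μ σ : ℝ) (ν : Measure ℝ) : levyKhintchine μ σ ν 0 = 0 := by
  rw [levyKhintchine_eq_mul_levySlope, zero_mul]

/-- A Lévy measure carried by `(-∞, 0)`. -/
structure IsNegLevyMeasure (ν : Measure ℝ) : Prop where
  carried : ν (Ici 0) = 0
  integrates : ∫⁻ x, ENNReal.ofReal (min 1 (x ^ 2)) ∂ν < ⊤

theorem IsSpectrallyNegativeTriplet.isNegLevyMeasure {μ σ : ℝ} {ν : Measure ℝ}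
    (h : IsSpectrallyNegativeTriplet μ σ ν) : IsNegLevyMeasure ν :=
  ⟨h.carried, h.integrates⟩

namespace IsNegLevyMeasure

variable {ν : Measure ℝ} (hν : IsNegLevyMeasure ν)
include hν

theorem ae_neg : ∀ᵐ x ∂ν, x < 0 := by
  rw [ae_iff]
  simp only [not_lt]
  exact hν.carried

theorem integrable_min : Integrable (fun x : ℝ => min 1 (x ^ 2)) ν := by
  refine ⟨by fun_prop, ?_⟩
  rw [hasFiniteIntegral_iff_ofReal (ae_of_all _ fun x => le_min zero_le_one (sq_nonneg x))]
  exact hν.integrates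

theorem integrable_of_bound {f : ℝ → ℝ} (hf : AEStronglyMeasurable f ν) (C : ℝ)
    (h : ∀ x < 0, |f x| ≤ C * min 1 (x ^ 2)) : Integrable f ν :=
  (hν.integrable_min.const_mul C).mono' hf (hν.ae_neg.mono h)

theorem integrable_compensatedPrimitive {t : ℝ} (ht : 0 < t) :
    Integrable (compensatedPrimitive t) ν :=
  hν.integrable_of_bound (measurable_compensatedPrimitive t).aestronglyMeasurable _
    fun _ hx => abs_compensatedPrimitive_le hx ht

/-- This monotonicity plays the role of convexity of the exponent throughout. -/
theorem levySlope_mono (μ σ : ℝ) {s t : ℝ} (hs : 0 < s) (hst : s ≤ t) :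
    levySlope μ σ ν s ≤ levySlope μ σ ν t := by
  have h : ∫ x, compensatedPrimitive t x ∂ν ≤ ∫ x, compensatedPrimitive s x ∂ν :=
    integral_mono_ae (hν.integrable_compensatedPrimitive (hs.trans_le hst))
      (hν.integrable_compensatedPrimitive hs)
      (hν.ae_neg.mono fun x hx => compensatedPrimitive_anti hx.le hst)
  have := mul_le_mul_of_nonneg_left hst (by positivity : 0 ≤ σ ^ 2 / 2)
  unfold levySlope
  linarith

theorem continuousOn_levyKhintchine (μ σ : ℝ) :
    ContinuousOn (levyKhintchine μ σ ν) (Ici 0) := by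
  intro t₀ _
  have h : ContinuousWithinAt (fun t => ∫ x, -(t * compensatedPrimitive t x) ∂ν) (Ici 0) t₀ := by
    refine continuousWithinAt_of_dominated
      (bound := fun x => ((t₀ + 1) ^ 2 / 2 + 1) * min 1 (x ^ 2)) ?_ ?_
      (hν.integrable_min.const_mul _) ?_
    · exact Eventually.of_forall fun t =>
        ((measurable_compensatedPrimitive t).const_mul t).neg.aestronglyMeasurable
    · filter_upwards [self_mem_nhdsWithin,
        mem_nhdsWithin_of_mem_nhds (Iio_mem_nhds (lt_add_one t₀))] with t ht ht'
      filter_upwards [hν.ae_neg] with x hx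
      rw [norm_neg, Real.norm_eq_abs]
      refine (abs_mul_compensatedPrimitive_le hx ht).trans ?_
      have : t ^ 2 ≤ (t₀ + 1) ^ 2 := pow_le_pow_left₀ ht (le_of_lt ht') 2
      gcongr
    · refine ae_of_all _ fun x => Continuous.continuousWithinAt ?_
      have := continuous_expPrimitive_left x
      unfold compensatedPrimitive
      fun_prop
  have h2 : levyKhintchine μ σ ν = fun t => -μ * t + σ ^ 2 / 2 * t ^ 2 +
      ∫ x, -(t * compensatedPrimitive t x) ∂ν := by
    funext t
    simp only [levyKhintchine, levyIntegrand_eq, neg_mul]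
  rw [h2]
  exact ContinuousWithinAt.add (by fun_prop) h

end IsNegLevyMeasure

/-! ### Limits of the slope, and non-monotone paths as growth at infinity -/

/-- Fatou's lemma as an integrability criterion. -/
theorem integrable_of_tendsto_of_integral_le {α : Type*} [MeasurableSpace α] {ν : Measure α}
    {f : ℕ → α → ℝ} {F : α → ℝ} (hf : ∀ n, Integrable (f n) ν) (h0 : ∀ n, 0 ≤ᵐ[ν] f n)
    (hF : ∀ᵐ x ∂ν, Tendsto (fun n => f n x) atTop (𝓝 (F x))) (C : ℝ)
    (hC : ∀ n, ∫ x, f n x ∂ν ≤ C) : Integrable F ν := by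
  refine ⟨aestronglyMeasurable_of_tendsto_ae atTop (fun n => (hf n).1) hF, ?_⟩
  have hb : ∀ n, ∫⁻ x, ‖f n x‖ₑ ∂ν ≤ ENNReal.ofReal C := fun n => by
    rw [lintegral_congr_ae ((h0 n).mono fun x hx => Real.enorm_of_nonneg hx),
      ← ofReal_integral_eq_lintegral_ofReal (hf n) (h0 n)]
    exact ENNReal.ofReal_le_ofReal (hC n)
  have h1 : ∫⁻ x, ‖F x‖ₑ ∂ν = ∫⁻ x, liminf (fun n => ‖f n x‖ₑ) atTop ∂ν :=
    lintegral_congr_ae (hF.mono fun x hx => (hx.enorm.liminf_eq).symm)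
  rw [HasFiniteIntegral, h1]
  refine (lintegral_liminf_le' fun n => (hf n).1.enorm).trans_lt (lt_of_le_of_lt ?_
    (ENNReal.ofReal_lt_top (r := C)))
  exact (liminf_le_liminf (Eventually.of_forall hb)).trans_eq (liminf_const _)

theorem tendsto_compensatedPrimitive_zero (x : ℝ) {l : Filter ℝ} (hl : l ≤ 𝓝 0) :
    Tendsto (fun t => compensatedPrimitive t x) l (𝓝 (compensatedPrimitive 0 x)) :=
  (((continuous_expPrimitive_left x).tendsto 0).mono_left hl).add_const _

theorem tendsto_compensatedPrimitive_atTop {x : ℝ} (hx : x ≤ 0) :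
    Tendsto (fun t => compensatedPrimitive t x) atTop
      (𝓝 (x * (Ioo (-1 : ℝ) 1).indicator 1 x)) := by
  have h : Tendsto (fun t => expPrimitive t x) atTop (𝓝 0) := by
    refine squeeze_zero' (Eventually.of_forall fun t => expPrimitive_nonneg t hx) ?_
      tendsto_inv_atTop_zero
    filter_upwards [eventually_gt_atTop 0] with t ht using expPrimitive_le_inv ht x
  simpa [compensatedPrimitive] using h.add_const (x * (Ioo (-1 : ℝ) 1).indicator 1 x)

theorem mul_indicator_le_compensatedPrimitive (t : ℝ) {x : ℝ} (hx : x ≤ 0) :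
    x * (Ioo (-1 : ℝ) 1).indicator 1 x ≤ compensatedPrimitive t x :=
  le_add_of_nonneg_left (expPrimitive_nonneg t hx)

theorem mul_indicator_one_eq (x : ℝ) :
    x * (Ioo (-1 : ℝ) 1).indicator 1 x = (Ioo (-1 : ℝ) 1).indicator (fun y => y) x := by
  by_cases h : x ∈ Ioo (-1 : ℝ) 1 <;> simp [h]

theorem abs_le_abs_add_abs_of_mem {a b c : ℝ} (h1 : a ≤ b) (h2 : b ≤ c) : |b| ≤ |a| + |c| := by
  rw [abs_le]
  constructor <;> linarith [neg_abs_le a, le_abs_self c, abs_nonneg a, abs_nonneg c]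

namespace IsNegLevyMeasure

variable {ν : Measure ℝ} (hν : IsNegLevyMeasure ν)
include hν

theorem ae_restrict_eq : ν.restrict (Ioo (-1) 1) = ν.restrict (Ioo (-1) 0) := by
  refine Measure.restrict_congr_set ?_
  filter_upwards [hν.ae_neg] with x hx
  refine propext ⟨fun h => ⟨h.1, hx⟩, fun h => ⟨h.1, h.2.trans one_pos⟩⟩

theorem integrable_mul_indicator_iff :
    Integrable (fun x : ℝ => x * (Ioo (-1 : ℝ) 1).indicator 1 x) ν ↔
      IntegrableOn (fun x : ℝ => x) (Ioo (-1) 0) ν := by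
  simp only [mul_indicator_one_eq]
  rw [integrable_indicator_iff measurableSet_Ioo, IntegrableOn, hν.ae_restrict_eq, IntegrableOn]

theorem integral_mul_indicator :
    ∫ x, x * (Ioo (-1 : ℝ) 1).indicator 1 x ∂ν = ∫ x in Ioo (-1 : ℝ) 0, x ∂ν := by
  simp only [mul_indicator_one_eq]
  rw [integral_indicator measurableSet_Ioo, hν.ae_restrict_eq]

/-- In the bounded variation case the slope of the exponent tends to the drift. -/
theorem tendsto_levySlope_atTop (μ : ℝ) (h : IntegrableOn (fun x : ℝ => x) (Ioo (-1) 0) ν) :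
    Tendsto (levySlope μ 0 ν) atTop (𝓝 (-μ - ∫ x in Ioo (-1 : ℝ) 0, x ∂ν)) := by
  have hi := hν.integrable_mul_indicator_iff.2 h
  rw [← hν.integral_mul_indicator]
  have : Tendsto (fun t => ∫ x, compensatedPrimitive t x ∂ν) atTop
      (𝓝 (∫ x, x * (Ioo (-1 : ℝ) 1).indicator 1 x ∂ν)) := by
    refine tendsto_integral_filter_of_dominated_convergence
      (fun x => |x * (Ioo (-1 : ℝ) 1).indicator 1 x| + |compensatedPrimitive 1 x|) ?_ ?_
      (hi.abs.add (hν.integrable_compensatedPrimitive one_pos).abs) ?_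
    · exact Eventually.of_forall fun t =>
        (measurable_compensatedPrimitive t).aestronglyMeasurable
    · filter_upwards [eventually_ge_atTop 1] with t ht
      filter_upwards [hν.ae_neg] with x hx
      exact abs_le_abs_add_abs_of_mem (mul_indicator_le_compensatedPrimitive t hx.le)
        (compensatedPrimitive_anti hx.le ht)
    · filter_upwards [hν.ae_neg] with x hx using tendsto_compensatedPrimitive_atTop hx.le
  refine (this.const_sub (-μ)).congr fun t => ?_
  simp [levySlope]

/-- A nonzero `σ` would make the slope grow linearly. For the small jumps, the integrals of `c_1 -
c_{n+1} ≥ 0` are bounded through the slope, and Fatou passes to the limit `n → ∞`, where `c_{n+1}`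
tends to the compensator alone. -/
theorem integrableOn_of_levySlope_le {μ σ C : ℝ}
    (h : ∀ t : ℝ, 1 ≤ t → levySlope μ σ ν t ≤ C) :
    σ = 0 ∧ IntegrableOn (fun x : ℝ => x) (Ioo (-1) 0) ν := by
  have h1 := hν.integrable_compensatedPrimitive one_pos
  have hle : ∀ t : ℝ, 1 ≤ t →
      ∫ x, compensatedPrimitive t x ∂ν ≤ ∫ x, compensatedPrimitive 1 x ∂ν := fun t ht =>
    integral_mono_ae (hν.integrable_compensatedPrimitive (one_pos.trans_le ht)) h1
      (hν.ae_neg.mono fun x hx => compensatedPrimitive_anti hx.le ht)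
  constructor
  · by_contra hσ
    have hpos : 0 < σ ^ 2 / 2 := by positivity
    have ht : Tendsto (fun t : ℝ => σ ^ 2 / 2 * t) atTop atTop :=
      tendsto_id.const_mul_atTop hpos
    obtain ⟨t, ht1, ht2⟩ := ((eventually_ge_atTop 1).and (ht.eventually_gt_atTop
      (C + μ + ∫ x, compensatedPrimitive 1 x ∂ν))).exists
    have := h t ht1
    have := hle t ht1
    unfold levySlope at *
    linarith
  · rw [← hν.integrable_mul_indicator_iff]
    have hn : ∀ n : ℕ, (1 : ℝ) ≤ n + 1 := fun n => by
      have : (0 : ℝ) ≤ n := n.cast_nonneg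
      linarith
    have hi : ∀ n : ℕ, Integrable (compensatedPrimitive ((n : ℝ) + 1)) ν := fun n =>
      hν.integrable_compensatedPrimitive (one_pos.trans_le (hn n))
    have key : Integrable (fun x => compensatedPrimitive 1 x -
        x * (Ioo (-1 : ℝ) 1).indicator 1 x) ν := by
      refine integrable_of_tendsto_of_integral_le
        (f := fun n x => compensatedPrimitive 1 x - compensatedPrimitive ((n : ℝ) + 1) x)
        (fun n => h1.sub (hi n)) (fun n => ?_) ?_
        ((∫ x, compensatedPrimitive 1 x ∂ν) + C + μ) (fun n => ?_)
      · filter_upwards [hν.ae_neg] with x hx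
        exact sub_nonneg.2 (compensatedPrimitive_anti hx.le (hn n))
      · filter_upwards [hν.ae_neg] with x hx
        exact ((tendsto_compensatedPrimitive_atTop hx.le).comp
          (tendsto_atTop_add_const_right _ 1 tendsto_natCast_atTop_atTop)).const_sub _
      · rw [integral_sub h1 (hi n)]
        have h2 := h _ (hn n)
        have : 0 ≤ σ ^ 2 / 2 * ((n : ℝ) + 1) := by positivity
        unfold levySlope at h2
        linarith
    refine (h1.sub key).congr (ae_of_all _ fun x => ?_)
    simp only [Pi.sub_apply, sub_sub_cancel]

/-- Fatou applied to `c_t - c_1 ≥ 0` along `t = 1/(n+1)`: the lower bound on the slope is an upper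
bound on their integrals. -/
theorem integrable_compensatedPrimitive_zero {μ σ C : ℝ}
    (h : ∀ t : ℝ, 0 < t → t ≤ 1 → C ≤ levySlope μ σ ν t) :
    Integrable (compensatedPrimitive 0) ν := by
  have h1 := hν.integrable_compensatedPrimitive one_pos
  have hn : ∀ n : ℕ, (0 : ℝ) < 1 / (n + 1) := fun n => Nat.one_div_pos_of_nat
  have hn' : ∀ n : ℕ, 1 / ((n : ℝ) + 1) ≤ 1 := fun n => by
    rw [div_le_one (by positivity)]
    have : (0 : ℝ) ≤ n := n.cast_nonneg
    linarith
  have hi : ∀ n : ℕ, Integrable (compensatedPrimitive (1 / ((n : ℝ) + 1))) ν := fun n =>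
    hν.integrable_compensatedPrimitive (hn n)
  have key : Integrable (fun x => compensatedPrimitive 0 x - compensatedPrimitive 1 x) ν := by
    refine integrable_of_tendsto_of_integral_le
      (f := fun n x => compensatedPrimitive (1 / ((n : ℝ) + 1)) x - compensatedPrimitive 1 x)
      (fun n => (hi n).sub h1) (fun n => ?_) ?_
      (-μ + σ ^ 2 / 2 - C - ∫ x, compensatedPrimitive 1 x ∂ν) (fun n => ?_)
    · filter_upwards [hν.ae_neg] with x hx
      exact sub_nonneg.2 (compensatedPrimitive_anti hx.le (hn' n))
    · refine ae_of_all _ fun x => ?_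
      exact ((tendsto_compensatedPrimitive_zero x le_rfl).comp
        tendsto_one_div_add_atTop_nhds_zero_nat).sub_const _
    · rw [integral_sub (hi n) h1]
      have h2 := h _ (hn n) (hn' n)
      have := mul_le_mul_of_nonneg_left (hn' n) (by positivity : 0 ≤ σ ^ 2 / 2)
      unfold levySlope at h2
      linarith
  refine (key.add h1).congr (ae_of_all _ fun x => ?_)
  simp only [Pi.add_apply, sub_add_cancel]

/-- If `ψ(t) / t` has a finite limit at `0+`, then the compensated primitive at `0` is integrable
and the limit is the slope at `0`. -/
theorem levySlope_zero_eq {μ σ m : ℝ} (h : Tendsto (levySlope μ σ ν) (𝓝[>] 0) (𝓝 m)) :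
    Integrable (compensatedPrimitive 0) ν ∧ levySlope μ σ ν 0 = m := by
  have h0 : Integrable (compensatedPrimitive 0) ν := by
    -- The slope is nondecreasing, so its limit at `0+` bounds it from below.
    refine hν.integrable_compensatedPrimitive_zero (μ := μ) (σ := σ) (C := m) fun t ht _ => ?_
    refine le_of_tendsto h ?_
    filter_upwards [Ioo_mem_nhdsGT ht] with s hs using hν.levySlope_mono μ σ hs.1 hs.2.le
  refine ⟨h0, tendsto_nhds_unique ?_ h⟩
  have : Tendsto (fun t => ∫ x, compensatedPrimitive t x ∂ν) (𝓝[>] 0)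
      (𝓝 (∫ x, compensatedPrimitive 0 x ∂ν)) := by
    refine tendsto_integral_filter_of_dominated_convergence
      (fun x => |compensatedPrimitive 1 x| + |compensatedPrimitive 0 x|) ?_ ?_
      ((hν.integrable_compensatedPrimitive one_pos).abs.add h0.abs) ?_
    · exact Eventually.of_forall fun t =>
        (measurable_compensatedPrimitive t).aestronglyMeasurable
    · filter_upwards [Ioo_mem_nhdsGT one_pos] with t ht
      filter_upwards [hν.ae_neg] with x hx
      exact abs_le_abs_add_abs_of_mem (compensatedPrimitive_anti hx.le ht.2.le)
        (compensatedPrimitive_anti hx.le ht.1.le)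
    · exact ae_of_all _ fun x => tendsto_compensatedPrimitive_zero x nhdsWithin_le_nhds
  refine Tendsto.sub ?_ this
  exact ((by fun_prop : Continuous fun t : ℝ => -μ + σ ^ 2 / 2 * t).tendsto 0).mono_left
    nhdsWithin_le_nhds

/-- Otherwise the slope increases to a drift that is at most 0, so the exponent is never positive.
The second hypothesis excludes a pure linear drift, whose exponent may also tend to infinity. -/
theorem not_monotone_of_tendsto {μ σ : ℝ}
    (h : Tendsto (levyKhintchine μ σ ν) atTop atTop) (h0 : σ ≠ 0 ∨ ν ≠ 0) :
    IsSpectrallyNegativeTriplet μ σ ν := by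
  refine ⟨hν.carried, hν.integrates, ?_⟩
  by_contra! hc
  obtain ⟨rfl, hint, hd⟩ := hc
  have hd := hd (h0.resolve_left (not_not.2 rfl))
  have hlim := hν.tendsto_levySlope_atTop μ hint
  obtain ⟨t, ht0, ht⟩ := ((eventually_gt_atTop 0).and (h.eventually_gt_atTop 0)).exists
  have : levySlope μ 0 ν t ≤ -μ - ∫ x in Ioo (-1 : ℝ) 0, x ∂ν := by
    refine ge_of_tendsto hlim ?_
    filter_upwards [eventually_ge_atTop t] with s hs using hν.levySlope_mono μ 0 ht0 hs
  rw [levyKhintchine_eq_mul_levySlope] at ht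
  nlinarith

end IsNegLevyMeasure

/-- One positive slope suffices, by monotonicity. If there is none, the slope is bounded above,
which forces `σ = 0`, integrable small jumps and drift at most 0. -/
theorem IsSpectrallyNegativeTriplet.tendsto_atTop {μ σ : ℝ} {ν : Measure ℝ}
    (h : IsSpectrallyNegativeTriplet μ σ ν) :
    Tendsto (levyKhintchine μ σ ν) atTop atTop := by
  have hν := h.isNegLevyMeasure
  obtain ⟨t, ht, hpos⟩ : ∃ t : ℝ, 1 ≤ t ∧ 0 < levySlope μ σ ν t := by
    by_contra! hc
    obtain ⟨rfl, hint⟩ := hν.integrableOn_of_levySlope_le hc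
    have := le_of_tendsto (hν.tendsto_levySlope_atTop μ hint)
      ((eventually_ge_atTop 1).mono fun t ht => hc t ht)
    rcases h.not_monotone with h1 | h1 | h1
    · exact h1 rfl
    · exact h1 hint
    · linarith [h1.2]
  refine tendsto_atTop_mono' atTop ?_ (tendsto_id.atTop_mul_const hpos)
  filter_upwards [eventually_ge_atTop t] with s hs
  rw [levyKhintchine_eq_mul_levySlope]
  exact mul_le_mul_of_nonneg_left (hν.levySlope_mono μ σ (by linarith) hs)
    (by simp only [id]; linarith)

/-! ### Roots of the exponent -/

theorem IsLaplaceExponent.map_zero {ψ : ℝ → ℝ} (h : IsLaplaceExponent ψ) : ψ 0 = 0 := by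
  obtain ⟨μ, σ, ν, -, hψ⟩ := h
  rw [hψ 0 le_rfl, levyKhintchine_zero]

theorem IsLaplaceExponent.tendsto_atTop {ψ : ℝ → ℝ} (h : IsLaplaceExponent ψ) :
    Tendsto ψ atTop atTop := by
  obtain ⟨μ, σ, ν, hT, hψ⟩ := h
  refine hT.tendsto_atTop.congr' ?_
  filter_upwards [eventually_ge_atTop 0] with t ht using (hψ t ht).symm

theorem IsLaplaceExponent.continuousOn {ψ : ℝ → ℝ} (h : IsLaplaceExponent ψ) :
    ContinuousOn ψ (Ici 0) := by
  obtain ⟨μ, σ, ν, hT, hψ⟩ := h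
  exact (hT.isNegLevyMeasure.continuousOn_levyKhintchine μ σ).congr fun t ht => hψ t ht

theorem IsLaplaceExponent.bddAbove_roots {ψ : ℝ → ℝ} (h : IsLaplaceExponent ψ) (q : ℝ) :
    BddAbove {t : ℝ | 0 ≤ t ∧ ψ t = q} := by
  obtain ⟨M, hM⟩ := eventually_atTop.1 (h.tendsto_atTop.eventually_gt_atTop q)
  refine ⟨M, fun t ht => ?_⟩
  by_contra! hc
  exact (hM t hc.le).ne' ht.2

theorem IsLaplaceExponent.le_largestRoot {ψ : ℝ → ℝ} (h : IsLaplaceExponent ψ) {q t : ℝ}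
    (ht : 0 ≤ t) (hq : ψ t = q) : t ≤ largestRoot ψ q :=
  le_csSup (h.bddAbove_roots q) ⟨ht, hq⟩

theorem IsLaplaceExponent.exists_root {ψ : ℝ → ℝ} (h : IsLaplaceExponent ψ) {s q : ℝ}
    (hs : 0 ≤ s) (hq : ψ s ≤ q) : ∃ t, s ≤ t ∧ ψ t = q := by
  obtain ⟨M, hM1, hM2⟩ := ((h.tendsto_atTop.eventually_ge_atTop q).and
    (eventually_ge_atTop s)).exists
  obtain ⟨t, ht, he⟩ := intermediate_value_Icc hM2
    (h.continuousOn.mono fun x hx => hs.trans hx.1) ⟨hq, hM1⟩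
  exact ⟨t, ht.1, he⟩

theorem IsLaplaceExponent.largestRoot_mem {ψ : ℝ → ℝ} (h : IsLaplaceExponent ψ) {q : ℝ}
    (hq : 0 ≤ q) : 0 ≤ largestRoot ψ q ∧ ψ (largestRoot ψ q) = q := by
  obtain ⟨t, ht, he⟩ := h.exists_root le_rfl (h.map_zero.trans_le hq)
  have hne : {t : ℝ | 0 ≤ t ∧ ψ t = q}.Nonempty := ⟨t, ht, he⟩
  refine IsClosed.csSup_mem ?_ hne (h.bddAbove_roots q)
  exact h.continuousOn.preimage_isClosed_of_isClosed isClosed_Ici (isClosed_singleton (x := q))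

theorem IsLaplaceExponent.nonneg_of_largestRoot_eq_zero {ψ : ℝ → ℝ} (h : IsLaplaceExponent ψ)
    (h0 : largestRoot ψ 0 = 0) {t : ℝ} (ht : 0 ≤ t) : 0 ≤ ψ t := by
  by_contra! hc
  obtain ⟨s, hs, he⟩ := h.exists_root ht hc.le
  have := h.le_largestRoot (ht.trans hs) he
  have : s = 0 := by linarith
  have : t = 0 := by linarith
  subst this
  exact hc.ne h.map_zero

/-! ### The tail measure and Fubini -/

/-- The density `1 ∧ x²` is positive `ν`-almost everywhere and gives a finite measure. S-finiteness
is needed for Fubini. -/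
theorem IsNegLevyMeasure.sFinite {ν : Measure ℝ} (hν : IsNegLevyMeasure ν) : SFinite ν := by
  have hfin : IsFiniteMeasure (ν.withDensity fun x => ENNReal.ofReal (min 1 (x ^ 2))) :=
    isFiniteMeasure_withDensity hν.integrates.ne
  have hac : ν ≪ ν.withDensity fun x => ENNReal.ofReal (min 1 (x ^ 2)) := by
    refine withDensity_absolutelyContinuous' (by fun_prop) ?_
    filter_upwards [hν.ae_neg] with x hx
    simpa using hx.ne
  exact sFinite_of_absolutelyContinuous hac

/-- The measure `ν((-∞, z)) dz` on `(-∞, 0)`, with the mass of `ν` at `x` spread over `(x, 0)`. -/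
noncomputable def tailMeasure (ν : Measure ℝ) : Measure ℝ :=
  ((ν.prod volume).restrict {p : ℝ × ℝ | p.1 < p.2 ∧ p.2 < 0}).map Prod.snd

theorem measurableSet_below_diagonal : MeasurableSet {p : ℝ × ℝ | p.1 < p.2 ∧ p.2 < 0} :=
  (measurableSet_lt measurable_fst measurable_snd).inter
    (measurableSet_lt measurable_snd measurable_const)

theorem tailMeasure_Ici (ν : Measure ℝ) : tailMeasure ν (Ici 0) = 0 := by
  rw [tailMeasure, Measure.map_apply measurable_snd measurableSet_Ici,
    Measure.restrict_apply (measurable_snd measurableSet_Ici)]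
  convert measure_empty (μ := ν.prod volume)
  ext p
  simp only [mem_inter_iff, mem_preimage, mem_Ici, mem_ofPred_eq, mem_empty_iff_false, iff_false]
  rintro ⟨h1, -, h2⟩
  exact h2.not_ge h1

theorem lintegral_tailMeasure (ν : Measure ℝ) {g : ℝ → ENNReal} (hg : Measurable g) :
    ∫⁻ z, g z ∂tailMeasure ν = ∫⁻ x, (∫⁻ z in Ioo x 0, g z) ∂ν := by
  rw [tailMeasure, lintegral_map hg measurable_snd,
    ← lintegral_indicator measurableSet_below_diagonal, lintegral_prod]
  swap
  · exact ((hg.comp measurable_snd).indicator measurableSet_below_diagonal).aemeasurable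
  refine lintegral_congr fun x => ?_
  rw [← lintegral_indicator measurableSet_Ioo]
  rfl

theorem integral_tailMeasure (ν : Measure ℝ) [SFinite ν] {g : ℝ → ℝ} (hg : Measurable g)
    (hi : Integrable g (tailMeasure ν)) :
    ∫ z, g z ∂tailMeasure ν = ∫ x, (∫ z in Ioo x 0, g z) ∂ν := by
  have hi' : Integrable ({p : ℝ × ℝ | p.1 < p.2 ∧ p.2 < 0}.indicator fun p => g p.2)
      (ν.prod volume) := by
    rw [integrable_indicator_iff measurableSet_below_diagonal]
    exact (integrable_map_measure hg.aestronglyMeasurable measurable_snd.aemeasurable).1 hi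
  rw [tailMeasure, integral_map measurable_snd.aemeasurable hg.aestronglyMeasurable,
    ← integral_indicator measurableSet_below_diagonal, integral_prod _ hi']
  congr 1
  funext x
  rw [← integral_indicator measurableSet_Ioo]
  rfl

theorem setIntegral_Ioo_eq_interval {x : ℝ} (hx : x ≤ 0) (g : ℝ → ℝ) :
    ∫ z in Ioo x 0, g z = ∫ z in x..0, g z := by
  rw [intervalIntegral.integral_of_le hx, integral_Ioc_eq_integral_Ioo]

/-- For small jumps `∫_x^0 |z| dz = x²/2` suffices; for large ones the integral is at most the
exponential primitive, which is then uncompensated. -/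
theorem integral_exp_mul_min_le {β x : ℝ} (hβ : 0 ≤ β) (hx : x < 0) :
    ∫ z in x..0, Real.exp (β * z) * min 1 |z| ≤ min 1 (x ^ 2) + |compensatedPrimitive β x| := by
  have hc : ∀ a b : ℝ, IntervalIntegrable (fun z : ℝ => Real.exp (β * z) * min 1 |z|) volume a b :=
    fun a b => Continuous.intervalIntegrable (by fun_prop) a b
  rcases lt_or_ge (-1) x with h | h
  · have h1 : ∫ z in x..0, Real.exp (β * z) * min 1 |z| ≤ ∫ z in x..0, -z := by
      refine intervalIntegral.integral_mono_on hx.le (hc _ _)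
        (Continuous.intervalIntegrable (by fun_prop) _ _) fun z hz => ?_
      have h2 : Real.exp (β * z) ≤ 1 := Real.exp_le_one_iff.2 (mul_nonpos_of_nonneg_of_nonpos hβ hz.2)
      have h3 : min 1 |z| ≤ -z := (min_le_right _ _).trans_eq (abs_of_nonpos hz.2)
      have h4 : 0 ≤ min 1 |z| := le_min zero_le_one (abs_nonneg z)
      nlinarith [Real.exp_pos (β * z)]
    rw [intervalIntegral.integral_neg, integral_id] at h1
    rw [min_one_sq_of_mem ⟨h, hx⟩]
    have := abs_nonneg (compensatedPrimitive β x)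
    nlinarith [sq_nonneg x]
  · rw [compensatedPrimitive_of_le h, abs_of_nonneg (expPrimitive_nonneg β hx.le)]
    have : ∫ z in x..0, Real.exp (β * z) * min 1 |z| ≤ expPrimitive β x :=
      intervalIntegral.integral_mono_on hx.le (hc _ _) (intervalIntegrable_exp_mul _ _ _)
        fun z _ => mul_le_of_le_one_right (Real.exp_pos _).le (min_le_left _ _)
    have : 0 ≤ min 1 (x ^ 2) := by positivity
    linarith

namespace IsNegLevyMeasure

variable {ν : Measure ℝ} (hν : IsNegLevyMeasure ν)
include hν

theorem integrable_tailMeasure {β : ℝ} (hβ : 0 ≤ β) (hi : Integrable (compensatedPrimitive β) ν) :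
    Integrable (fun z => Real.exp (β * z) * min 1 |z|) (tailMeasure ν) := by
  refine ⟨by fun_prop, ?_⟩
  have h0 : ∀ z : ℝ, 0 ≤ Real.exp (β * z) * min 1 |z| := fun z => by positivity
  rw [hasFiniteIntegral_iff_ofReal (ae_of_all _ h0), lintegral_tailMeasure ν (by fun_prop)]
  have hb : Integrable (fun x => min 1 (x ^ 2) + |compensatedPrimitive β x|) ν :=
    hν.integrable_min.add hi.abs
  refine lt_of_le_of_lt (lintegral_mono_ae ?_) hb.lintegral_lt_top
  filter_upwards [hν.ae_neg] with x hx
  rw [← ofReal_integral_eq_lintegral_ofReal _ (ae_of_all _ h0), setIntegral_Ioo_eq_interval hx.le]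
  · exact ENNReal.ofReal_le_ofReal (integral_exp_mul_min_le hβ hx)
  · exact (Continuous.integrableOn_Icc (by fun_prop)).mono_set Ioo_subset_Icc_self

theorem integral_exp_sub_one_tailMeasure {β u : ℝ}
    (hi : Integrable (compensatedPrimitive β) ν) (hi' : Integrable (compensatedPrimitive (u + β)) ν)
    (hg : Integrable (fun z => Real.exp (β * z) * (Real.exp (u * z) - 1)) (tailMeasure ν)) :
    ∫ z, Real.exp (β * z) * (Real.exp (u * z) - 1) ∂tailMeasure ν =
      (∫ x, compensatedPrimitive (u + β) x ∂ν) - ∫ x, compensatedPrimitive β x ∂ν := by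
  have := hν.sFinite
  rw [integral_tailMeasure ν (by fun_prop) hg, ← integral_sub hi' hi]
  refine integral_congr_ae ?_
  filter_upwards [hν.ae_neg] with x hx
  rw [setIntegral_Ioo_eq_interval hx.le]
  simp only [compensatedPrimitive, add_sub_add_right_eq_sub, expPrimitive]
  rw [← intervalIntegral.integral_sub (intervalIntegrable_exp_mul _ _ _)
    (intervalIntegrable_exp_mul _ _ _)]
  refine intervalIntegral.integral_congr fun z _ => ?_
  simp only [add_mul, Real.exp_add]
  ring

end IsNegLevyMeasure

/-! ### Adding the killing rate -/

/-- The tail measure of `ν` enlarged by a mass `q` at `-∞`. -/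
noncomputable def killedTailMeasure (ν : Measure ℝ) (q : ℝ) : Measure ℝ :=
  tailMeasure ν + ENNReal.ofReal q • volume.restrict (Iio 0)

theorem killedTailMeasure_Ici (ν : Measure ℝ) (q : ℝ) : killedTailMeasure ν q (Ici 0) = 0 := by
  rw [killedTailMeasure, Measure.add_apply, tailMeasure_Ici, Measure.smul_apply,
    Measure.restrict_apply measurableSet_Ici, Ici_inter_Iio, Ico_self]
  simp

theorem integrableOn_exp_mul_Iio {s : ℝ} (hs : 0 < s) :
    IntegrableOn (fun z : ℝ => Real.exp (s * z)) (Iio 0) :=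
  (integrableOn_exp_mul_Iic hs 0).mono_set Iio_subset_Iic_self

theorem integral_exp_mul_Iio {s : ℝ} (hs : 0 < s) :
    ∫ z in Iio (0 : ℝ), Real.exp (s * z) = 1 / s := by
  rw [← integral_Iic_eq_integral_Iio, integral_exp_mul_Iic hs]
  simp

theorem integrable_of_le_min {m : Measure ℝ} (hm : ∀ᵐ z ∂m, z < 0) {β : ℝ}
    (hi : Integrable (fun z => Real.exp (β * z) * min 1 |z|) m) {g : ℝ → ℝ} (hg : Measurable g)
    (C : ℝ) (h : ∀ z < 0, |g z| ≤ C * min 1 |z|) :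
    Integrable (fun z => Real.exp (β * z) * g z) m := by
  refine (hi.const_mul C).mono' (by fun_prop) (hm.mono fun z hz => ?_)
  rw [Real.norm_eq_abs, abs_mul, Real.abs_exp]
  nlinarith [mul_le_mul_of_nonneg_left (h z hz) (Real.exp_pos (β * z)).le]

theorem abs_exp_sub_one_le_min {u : ℝ} (hu : 0 ≤ u) {z : ℝ} (hz : z < 0) :
    |Real.exp (u * z) - 1| ≤ (u + 1) * min 1 |z| := by
  have h1 : Real.exp (u * z) ≤ 1 :=
    Real.exp_le_one_iff.2 (mul_nonpos_of_nonneg_of_nonpos hu hz.le)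
  rw [abs_of_nonpos (by linarith), abs_of_neg hz]
  have h2 := Real.exp_pos (u * z)
  have h3 := Real.add_one_le_exp (u * z)
  rcases min_cases 1 (-z) with ⟨h, _⟩ | ⟨h, _⟩ <;> rw [h] <;> nlinarith

theorem abs_mul_indicator_le_min (z : ℝ) :
    |z * (Ioo (-1 : ℝ) 1).indicator 1 z| ≤ 1 * min 1 |z| := by
  rw [one_mul]
  by_cases h : z ∈ Ioo (-1 : ℝ) 1
  · simpa [h] using (abs_lt.2 h).le
  · simp [h]

theorem ae_neg_of_Ici {m : Measure ℝ} (h : m (Ici 0) = 0) : ∀ᵐ z ∂m, z < 0 := by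
  rw [ae_iff]
  simp only [not_lt]
  exact h

theorem IsNegLevyMeasure.integrable_killedTailMeasure {ν : Measure ℝ} (hν : IsNegLevyMeasure ν)
    {β q : ℝ} (hβ : 0 ≤ β) (hq : β = 0 → q = 0) (hi : Integrable (compensatedPrimitive β) ν) :
    Integrable (fun z => Real.exp (β * z) * min 1 |z|) (killedTailMeasure ν q) := by
  refine (hν.integrable_tailMeasure hβ hi).add_measure ?_
  rcases hβ.eq_or_lt with rfl | hβ
  · simp [hq rfl]
  · refine Integrable.smul_measure ?_ ENNReal.ofReal_ne_top
    refine (integrableOn_exp_mul_Iio hβ).mono' (by fun_prop) (ae_of_all _ fun z => ?_)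
    rw [Real.norm_of_nonneg (by positivity)]
    exact mul_le_of_le_one_right (Real.exp_pos _).le (min_le_left _ _)

/-- The mass at `-∞` contributes `q ∫_{-∞}^0 e^{βz}(e^{uz} - 1) dz`. For `β = 0` this integral
diverges, but then `q = 0`. -/
theorem IsNegLevyMeasure.integral_killedTailMeasure {ν : Measure ℝ} (hν : IsNegLevyMeasure ν)
    {β q u : ℝ} (hβ : 0 ≤ β) (hu : 0 < u) (hq0 : 0 ≤ q) (hq : β = 0 → q = 0)
    (hi : Integrable (compensatedPrimitive β) ν) :
    ∫ z, Real.exp (β * z) * (Real.exp (u * z) - 1) ∂killedTailMeasure ν q =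
      (∫ x, compensatedPrimitive (u + β) x ∂ν) - (∫ x, compensatedPrimitive β x ∂ν) +
        q * (1 / (u + β) - 1 / β) := by
  have h := integrable_of_le_min (ae_neg_of_Ici (killedTailMeasure_Ici ν q))
    (hν.integrable_killedTailMeasure hβ hq hi) (g := fun z => Real.exp (u * z) - 1)
    (by fun_prop) _ fun z hz => abs_exp_sub_one_le_min hu.le hz
  have h1 := h.left_of_add_measure
  rw [killedTailMeasure, integral_add_measure h1 h.right_of_add_measure,
    hν.integral_exp_sub_one_tailMeasure hi
      (hν.integrable_compensatedPrimitive (by linarith)) h1, integral_smul_measure,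
    ENNReal.toReal_ofReal hq0, smul_eq_mul]
  congr 1
  rcases hβ.eq_or_lt with rfl | hβ
  · simp [hq rfl]
  · congr 1
    have he : ∀ z : ℝ, Real.exp (β * z) * (Real.exp (u * z) - 1) =
        Real.exp ((u + β) * z) - Real.exp (β * z) := fun z => by
      rw [add_mul, Real.exp_add]
      ring
    simp only [he]
    rw [integral_sub (integrableOn_exp_mul_Iio (by linarith)) (integrableOn_exp_mul_Iio hβ),
      integral_exp_mul_Iio (by linarith), integral_exp_mul_Iio hβ]

/-! ### The exponent of the tilted measure -/

/-- The Lévy measure of the transformed exponent: the exponential tilt of `ν + δ κ`. -/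
noncomputable def tiltedSum (ν κ : Measure ℝ) (β δ : ℝ) : Measure ℝ :=
  (ν + ENNReal.ofReal δ • κ).withDensity fun z => ENNReal.ofReal (Real.exp (β * z))

section tiltedSum

variable {ν κ : Measure ℝ} {β δ : ℝ}

theorem integrable_tiltedSum {g : ℝ → ℝ}
    (hν : Integrable (fun z => Real.exp (β * z) * g z) ν)
    (hκ : Integrable (fun z => Real.exp (β * z) * g z) κ) :
    Integrable g (tiltedSum ν κ β δ) := by
  rw [tiltedSum, integrable_withDensity_iff_integrable_smul' (by fun_prop)
    (ae_of_all _ fun z => ENNReal.ofReal_lt_top)]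
  simp only [ENNReal.toReal_ofReal (Real.exp_pos _).le, smul_eq_mul]
  exact hν.add_measure (hκ.smul_measure ENNReal.ofReal_ne_top)

theorem integral_tiltedSum (hδ : 0 ≤ δ) {g : ℝ → ℝ}
    (hν : Integrable (fun z => Real.exp (β * z) * g z) ν)
    (hκ : Integrable (fun z => Real.exp (β * z) * g z) κ) :
    ∫ z, g z ∂tiltedSum ν κ β δ =
      (∫ z, Real.exp (β * z) * g z ∂ν) + δ * ∫ z, Real.exp (β * z) * g z ∂κ := by
  rw [tiltedSum, integral_withDensity_eq_integral_toReal_smul (by fun_prop)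
    (ae_of_all _ fun z => ENNReal.ofReal_lt_top)]
  simp only [ENNReal.toReal_ofReal (Real.exp_pos _).le, smul_eq_mul]
  rw [integral_add_measure hν (hκ.smul_measure ENNReal.ofReal_ne_top), integral_smul_measure,
    ENNReal.toReal_ofReal hδ, smul_eq_mul]

theorem tiltedSum_ne_zero (h : ν ≠ 0) : tiltedSum ν κ β δ ≠ 0 := by
  intro h0
  have hac : ν + ENNReal.ofReal δ • κ ≪ tiltedSum ν κ β δ :=
    withDensity_absolutelyContinuous' (by fun_prop) (ae_of_all _ fun z => by
      simpa using Real.exp_pos (β * z))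
  rw [h0, Measure.absolutelyContinuous_zero_iff] at hac
  refine h (le_antisymm ?_ (Measure.zero_le ν))
  rw [← hac]
  exact Measure.le_add_right le_rfl

theorem min_one_sq_le_min_one_abs (z : ℝ) : min 1 (z ^ 2) ≤ min 1 |z| := by
  refine le_min (min_le_left _ _) ?_
  rcases le_total 1 |z| with h | h
  · exact (min_le_left _ _).trans h
  · refine (min_le_right _ _).trans ?_
    rw [← sq_abs]
    nlinarith [abs_nonneg z]

theorem IsNegLevyMeasure.tiltedSum (hν : IsNegLevyMeasure ν) (hκ : κ (Ici 0) = 0) (hβ : 0 ≤ β)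
    (hi : Integrable (fun z => Real.exp (β * z) * min 1 |z|) κ) :
    IsNegLevyMeasure (tiltedSum ν κ β δ) := by
  refine ⟨?_, Integrable.lintegral_lt_top (integrable_tiltedSum ?_ ?_)⟩
  · refine withDensity_absolutelyContinuous _ _ ?_
    simp [hκ, hν.carried]
  · refine hν.integrable_of_bound (by fun_prop) 1 fun z hz => ?_
    rw [abs_of_nonneg (by positivity)]
    exact mul_le_mul_of_nonneg_right
      (Real.exp_le_one_iff.2 (mul_nonpos_of_nonneg_of_nonpos hβ hz.le)) (by positivity)
  · refine integrable_of_le_min (ae_neg_of_Ici hκ) hi (by fun_prop) 1 fun z _ => ?_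
    rw [abs_of_nonneg (by positivity), one_mul]
    exact min_one_sq_le_min_one_abs z

theorem measurable_mul_indicator :
    Measurable fun z : ℝ => z * (Ioo (-1 : ℝ) 1).indicator 1 z :=
  measurable_id.mul (measurable_one.indicator measurableSet_Ioo)

theorem IsNegLevyMeasure.integrable_truncation_defect (hν : IsNegLevyMeasure ν) (hβ : 0 ≤ β) :
    Integrable (fun z : ℝ => z * (Ioo (-1 : ℝ) 1).indicator 1 z * (1 - Real.exp (β * z))) ν := by
  have hm := measurable_mul_indicator
  refine hν.integrable_of_bound (by fun_prop) β fun z hz => ?_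
  by_cases h : z ∈ Ioo (-1 : ℝ) 1
  · have h1 := Real.add_one_le_exp (β * z)
    have h2 : Real.exp (β * z) ≤ 1 :=
      Real.exp_le_one_iff.2 (mul_nonpos_of_nonneg_of_nonpos hβ hz.le)
    rw [min_one_sq_of_mem ⟨h.1, hz⟩, indicator_of_mem h, Pi.one_apply, mul_one, abs_mul,
      abs_of_neg hz, abs_of_nonneg (by linarith)]
    nlinarith
  · rw [indicator_of_notMem h]
    simp only [mul_zero, zero_mul, abs_zero]
    positivity

/-- The new drift collects everything linear in `u`: the cross term of `σ²(u+β)²/2`, the term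
`-δσ²u/2`, the mismatch between tilted and untilted compensators of `ν`, and the compensator of the
`κ` part, which is integrable by itself. -/
theorem levyKhintchine_tiltedSum (hν : IsNegLevyMeasure ν) (hκ : κ (Ici 0) = 0)
    (hβ : 0 ≤ β) (hδ : 0 ≤ δ) (hi : Integrable (fun z => Real.exp (β * z) * min 1 |z|) κ)
    (hβi : Integrable (compensatedPrimitive β) ν) (μ σ : ℝ) {u : ℝ} (hu : 0 < u) :
    levyKhintchine (μ - σ ^ 2 * β + δ * σ ^ 2 / 2 +
        (∫ z, z * (Ioo (-1 : ℝ) 1).indicator 1 z * (1 - Real.exp (β * z)) ∂ν) -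
        δ * ∫ z, Real.exp (β * z) * (z * (Ioo (-1 : ℝ) 1).indicator 1 z) ∂κ)
        σ (tiltedSum ν κ β δ) u =
      (u + β) * levySlope μ σ ν (u + β) - β * levySlope μ σ ν β +
        δ * ((∫ z, Real.exp (β * z) * (Real.exp (u * z) - 1) ∂κ) - σ ^ 2 / 2 * u) := by
  have hκ' := ae_neg_of_Ici hκ
  have hm := measurable_mul_indicator
  have e1 : ∀ z : ℝ, Real.exp (β * z) * (Real.exp (u * z) - 1 - u * z *
      (Ioo (-1 : ℝ) 1).indicator 1 z) = -(u + β) * compensatedPrimitive (u + β) z +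
        β * compensatedPrimitive β z +
        u * (z * (Ioo (-1 : ℝ) 1).indicator 1 z * (1 - Real.exp (β * z))) := fun z => by
    have h1 := levyIntegrand_eq (u + β) z
    have h2 := levyIntegrand_eq β z
    have h3 : Real.exp ((u + β) * z) = Real.exp (u * z) * Real.exp (β * z) := by
      rw [add_mul, Real.exp_add]
    rw [h3] at h1
    linear_combination h1 - h2
  have e2 : ∀ z : ℝ, Real.exp (β * z) * (Real.exp (u * z) - 1 - u * z *
      (Ioo (-1 : ℝ) 1).indicator 1 z) = Real.exp (β * z) * (Real.exp (u * z) - 1) -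
        u * (Real.exp (β * z) * (z * (Ioo (-1 : ℝ) 1).indicator 1 z)) := fun z => by ring
  have i1 := (hν.integrable_compensatedPrimitive (by linarith : 0 < u + β)).const_mul (-(u + β))
  have i2 := hβi.const_mul β
  have i3 := (hν.integrable_truncation_defect hβ).const_mul u
  have i4 := integrable_of_le_min hκ' hi (g := fun z => Real.exp (u * z) - 1)
    (by fun_prop) _ fun z hz => abs_exp_sub_one_le_min hu.le hz
  have i5 := (integrable_of_le_min hκ' hi hm _ fun z _ => abs_mul_indicator_le_min z).const_mul u
  have j1 : ∫ z, Real.exp (β * z) * (Real.exp (u * z) - 1 - u * z *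
      (Ioo (-1 : ℝ) 1).indicator 1 z) ∂ν = -(u + β) * (∫ z, compensatedPrimitive (u + β) z ∂ν) +
        β * (∫ z, compensatedPrimitive β z ∂ν) +
        u * ∫ z, z * (Ioo (-1 : ℝ) 1).indicator 1 z * (1 - Real.exp (β * z)) ∂ν := by
    simp only [e1]
    have i12 : Integrable (fun z => -(u + β) * compensatedPrimitive (u + β) z +
        β * compensatedPrimitive β z) ν := i1.add i2
    rw [integral_add i12 i3, integral_add i1 i2]
    simp only [integral_const_mul]
  have j2 : ∫ z, Real.exp (β * z) * (Real.exp (u * z) - 1 - u * z *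
      (Ioo (-1 : ℝ) 1).indicator 1 z) ∂κ = (∫ z, Real.exp (β * z) * (Real.exp (u * z) - 1) ∂κ) -
        u * ∫ z, Real.exp (β * z) * (z * (Ioo (-1 : ℝ) 1).indicator 1 z) ∂κ := by
    simp only [e2]
    rw [integral_sub i4 i5, integral_const_mul]
  have k1 : Integrable (fun z => Real.exp (β * z) * (Real.exp (u * z) - 1 - u * z *
      (Ioo (-1 : ℝ) 1).indicator 1 z)) ν := by
    simp only [e1]
    exact (i1.add i2).add i3
  have k2 : Integrable (fun z => Real.exp (β * z) * (Real.exp (u * z) - 1 - u * z *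
      (Ioo (-1 : ℝ) 1).indicator 1 z)) κ := by
    simp only [e2]
    exact i4.sub i5
  rw [levyKhintchine, integral_tiltedSum hδ k1 k2, j1, j2]
  unfold levySlope
  ring

end tiltedSum

/-! ### The transform preserves Laplace exponents -/

theorem IsSpectrallyNegativeTriplet.sigma_ne_zero_or {μ σ : ℝ} {ν : Measure ℝ}
    (h : IsSpectrallyNegativeTriplet μ σ ν) : σ ≠ 0 ∨ ν ≠ 0 := by
  rcases h.not_monotone with h | h | h
  · exact Or.inl h
  · refine Or.inr ?_
    rintro rfl
    exact h (by simp [IntegrableOn])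
  · exact Or.inr h.1

theorem tendsto_expTransform_atTop {f : ℝ → ℝ} (hf : Tendsto f atTop atTop) (δ β : ℝ) :
    Tendsto (expTransform δ β f) atTop atTop := by
  have h1 : Tendsto (fun u : ℝ => u + β) atTop atTop :=
    tendsto_atTop_add_const_right _ β tendsto_id
  have h2 : Tendsto (fun u : ℝ => (u + β - δ) / (u + β)) atTop (𝓝 1) := by
    have h3 : Tendsto (fun u : ℝ => 1 - δ / (u + β)) atTop (𝓝 (1 - 0)) :=
      (h1.const_div_atTop δ).const_sub 1
    rw [sub_zero] at h3
    refine h3.congr' ?_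
    filter_upwards [h1.eventually_gt_atTop 0] with u hu
    field_simp
  exact tendsto_atTop_add_const_right _ _ (h2.pos_mul_atTop one_pos (hf.comp h1))

theorem expTransform_zero (δ β : ℝ) (f : ℝ → ℝ) : expTransform δ β f 0 = 0 := by
  simp [expTransform]

theorem hasRightDerivAtZero_levySlope {ψ : ℝ → ℝ} {μ σ : ℝ} {ν : Measure ℝ}
    (hψ : ∀ t : ℝ, 0 ≤ t → ψ t = levyKhintchine μ σ ν t) (h : HasRightDerivAtZero ψ 0) :
    Tendsto (levySlope μ σ ν) (𝓝[>] 0) (𝓝 0) := by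
  rw [HasRightDerivAtZero, ← EReal.coe_zero, EReal.tendsto_coe] at h
  refine h.congr' ?_
  filter_upwards [self_mem_nhdsWithin] with t ht
  rw [hψ t (le_of_lt ht), hψ 0 le_rfl, levyKhintchine_zero, sub_zero,
    levyKhintchine_eq_mul_levySlope, mul_div_cancel_left₀ _ (ne_of_gt ht)]

/-- The transform `T_{δ,β}` preserves Laplace exponents. -/
theorem IsLaplaceExponent.expTransform {ψ : ℝ → ℝ} (hψ : IsLaplaceExponent ψ) {q δ β : ℝ}
    (hq : 0 ≤ q) (hδ : 0 ≤ δ) (hβ : 0 ≤ β) (h0 : β = 0 → HasRightDerivAtZero ψ 0 ∧ q = 0) :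
    IsLaplaceExponent (expTransform δ β (killedExponent ψ q)) := by
  have hlim : Tendsto (_root_.expTransform δ β (killedExponent ψ q)) atTop atTop :=
    tendsto_expTransform_atTop (tendsto_atTop_add_const_right _ (-q) hψ.tendsto_atTop) δ β
  obtain ⟨μ, σ, ν, hT, hψ⟩ := hψ
  have hν := hT.isNegLevyMeasure
  have hβ0 : Integrable (compensatedPrimitive β) ν ∧ (β = 0 → levySlope μ σ ν 0 = 0) := by
    rcases hβ.eq_or_lt with rfl | hβ
    · have := hν.levySlope_zero_eq (hasRightDerivAtZero_levySlope hψ (h0 rfl).1)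
      exact ⟨this.1, fun _ => this.2⟩
    · exact ⟨hν.integrable_compensatedPrimitive hβ, fun h => absurd h hβ.ne'⟩
  obtain ⟨hβi, hS⟩ := hβ0
  have hq0 : β = 0 → q = 0 := fun h => (h0 h).2
  have hκ := killedTailMeasure_Ici ν q
  have hκi := hν.integrable_killedTailMeasure hβ hq0 hβi
  have heq : ∀ u : ℝ, 0 ≤ u → _root_.expTransform δ β (killedExponent ψ q) u =
      levyKhintchine (μ - σ ^ 2 * β + δ * σ ^ 2 / 2 +
        (∫ z, z * (Ioo (-1 : ℝ) 1).indicator 1 z * (1 - Real.exp (β * z)) ∂ν) -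
        δ * ∫ z, Real.exp (β * z) * (z * (Ioo (-1 : ℝ) 1).indicator 1 z) ∂killedTailMeasure ν q)
        σ (tiltedSum ν (killedTailMeasure ν q) β δ) u := by
    intro u hu
    rcases hu.eq_or_lt with rfl | hu
    · rw [levyKhintchine_zero, expTransform_zero]
    rw [levyKhintchine_tiltedSum hν hκ hβ hδ hκi hβi μ σ hu,
      hν.integral_killedTailMeasure hβ hu hq hq0 hβi]
    simp only [_root_.expTransform, killedExponent]
    rw [hψ (u + β) (by linarith), hψ β hβ, levyKhintchine_eq_mul_levySlope,
      levyKhintchine_eq_mul_levySlope]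
    have hA : (∫ z, compensatedPrimitive (u + β) z ∂ν) =
        -μ + σ ^ 2 / 2 * (u + β) - levySlope μ σ ν (u + β) := by
      unfold levySlope
      ring
    have hB : (∫ z, compensatedPrimitive β z ∂ν) =
        -μ + σ ^ 2 / 2 * β - levySlope μ σ ν β := by
      unfold levySlope
      ring
    rw [hA, hB]
    -- At `β = 0` the slope at 0 and `q` both vanish, so the terms divided by `β`, which are 0 by
    -- convention, agree with their limits.
    rcases hβ.eq_or_lt with rfl | hβ
    · rw [hS rfl, hq0 rfl]
      field_simp
      ring
    · field_simp
      ring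
  refine ⟨_, _, _, ?_, heq⟩
  refine (hν.tiltedSum hκ hβ hκi).not_monotone_of_tendsto (hlim.congr' ?_)
    (hT.sigma_ne_zero_or.imp_right tiltedSum_ne_zero)
  filter_upwards [eventually_ge_atTop 0] with u hu using heq u hu

/-- A Laplace exponent with `ψ'(0+) ≤ 0` and no positive root has `ψ'(0+) = 0`. -/
theorem IsLaplaceExponent.hasRightDerivAtZero_of_largestRoot {ψ : ℝ → ℝ}
    (hψ : IsLaplaceExponent ψ) {m : EReal} (hm : HasRightDerivAtZero ψ m) (hm0 : m ≤ 0)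
    (h0 : largestRoot ψ 0 = 0) : HasRightDerivAtZero ψ 0 := by
  have : 0 ≤ m := by
    refine ge_of_tendsto hm ?_
    filter_upwards [self_mem_nhdsWithin] with t ht
    rw [hψ.map_zero, sub_zero]
    exact EReal.coe_nonneg.2
      (div_nonneg (hψ.nonneg_of_largestRoot_eq_zero h0 (le_of_lt ht)) (le_of_lt ht))
  rwa [le_antisymm hm0 this] at hm
-- Uniqueness of scale functions
open scoped BoundedContinuousFunction

/-- The function `x ↦ exp (-x)` on `[0, ∞)`. -/
noncomputable def expNegNNReal : NNReal →ᵇ ℝ :=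
  BoundedContinuousFunction.ofNormedAddCommGroup (fun x : NNReal => Real.exp (-x)) (by fun_prop) 1
    fun x => by simp

theorem expNegNNReal_apply (x : NNReal) : expNegNNReal x = Real.exp (-x) := rfl

/-- The algebra of polynomials in `x ↦ exp (-x)`. -/
noncomputable def expNegPolynomials : StarSubalgebra ℝ (NNReal →ᵇ ℝ) where
  toSubalgebra := Algebra.adjoin ℝ {expNegNNReal}
  star_mem' := fun {f} hf => by
    have : star f = f := by
      ext x
      simp
    rw [this]
    exact hf

/-- A finite measure on `[0, ∞)` is determined by its Laplace transform at the integers. -/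
theorem ext_of_integral_exp_neg_nat {P P' : Measure NNReal} [IsFiniteMeasure P]
    [IsFiniteMeasure P']
    (h : ∀ n : ℕ, ∫ x : NNReal, Real.exp (-x) ^ n ∂P = ∫ x : NNReal, Real.exp (-x) ^ n ∂P') :
    P = P' := by
  refine ext_of_forall_mem_subalgebra_integral_eq_of_pseudoEMetric_complete_countable
    (𝕜 := ℝ) (A := expNegPolynomials) ?_ ?_
  · intro x y hxy
    refine ⟨expNegNNReal, ⟨expNegNNReal.toContinuousMap, ⟨expNegNNReal, ?_, rfl⟩, rfl⟩, ?_⟩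
    · exact Algebra.self_mem_adjoin_singleton ℝ expNegNNReal
    · simp only [expNegNNReal_apply]
      intro he
      exact hxy (NNReal.coe_injective (neg_injective (Real.exp_injective he)))
  · intro g hg
    have hg' : g ∈ Algebra.adjoin ℝ {expNegNNReal} := hg
    rw [Algebra.adjoin_singleton_eq_range_aeval] at hg'
    obtain ⟨p, rfl⟩ := hg'
    clear hg
    induction p using Polynomial.induction_on' with
    | add p r hp hr =>
      simp only [map_add, BoundedContinuousFunction.coe_add,
        Pi.add_apply] at hp hr ⊢
      rw [integral_add (BoundedContinuousFunction.integrable _ _)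
        (BoundedContinuousFunction.integrable _ _),
        integral_add (BoundedContinuousFunction.integrable _ _)
        (BoundedContinuousFunction.integrable _ _)]
      exact congrArg₂ _ hp hr
    | monomial n a =>
      have he : ∀ x : NNReal, (Polynomial.aeval expNegNNReal (Polynomial.monomial n a)) x =
          a * Real.exp (-x) ^ n := fun x => by
        rw [Polynomial.aeval_monomial, BoundedContinuousFunction.mul_apply,
          BoundedContinuousFunction.algebraMap_apply, BoundedContinuousFunction.pow_apply,
          expNegNNReal_apply]
        simp
      refine (integral_congr_ae (ae_of_all _ he)).trans (Eq.trans ?_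
        (integral_congr_ae (ae_of_all _ he)).symm)
      rw [integral_const_mul, integral_const_mul, h n]

/-- A nonnegative function on `(0, ∞)` is determined almost everywhere by its Laplace transform
at `t, t + 1, t + 2, …`. -/
theorem ae_eq_of_laplace_eq {V W : ℝ → ℝ} (hV0 : ∀ x, 0 ≤ V x) (hW0 : ∀ x, 0 ≤ W x) {t : ℝ}
    (hV : IntegrableOn (fun x => Real.exp (-t * x) * V x) (Ioi 0))
    (hW : IntegrableOn (fun x => Real.exp (-t * x) * W x) (Ioi 0))
    (h : ∀ n : ℕ, ∫ x in Ioi (0 : ℝ), Real.exp (-(t + n) * x) * V x =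
      ∫ x in Ioi (0 : ℝ), Real.exp (-(t + n) * x) * W x) :
    ∀ᵐ x, x ∈ Ioi (0 : ℝ) → V x = W x := by
  have hpos : ∀ {U : ℝ → ℝ}, (∀ x, 0 ≤ U x) → ∀ x, 0 ≤ Real.exp (-t * x) * U x :=
    fun hU x => mul_nonneg (Real.exp_pos _).le (hU x)
  -- The weight `e^{-tx}` makes the measure finite; its integral of `e^{-nx}` is the Laplace
  -- transform at `t + n`.
  set m : (ℝ → ℝ) → Measure ℝ := fun U => (volume.restrict (Ioi 0)).withDensity
    fun x => ENNReal.ofReal (Real.exp (-t * x) * U x) with hm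
  have hfin : ∀ {U : ℝ → ℝ}, IntegrableOn (fun x => Real.exp (-t * x) * U x) (Ioi 0) →
      IsFiniteMeasure (m U) := fun hU =>
    isFiniteMeasure_withDensity (Integrable.lintegral_lt_top hU).ne
  have hint : ∀ {U : ℝ → ℝ}, (∀ x, 0 ≤ U x) →
      IntegrableOn (fun x => Real.exp (-t * x) * U x) (Ioi 0) → ∀ n : ℕ,
      ∫ x : NNReal, Real.exp (-x) ^ n ∂((m U).map Real.toNNReal) =
        ∫ x in Ioi (0 : ℝ), Real.exp (-(t + n) * x) * U x := fun {U} hU0 hU n => by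
    rw [integral_map (by fun_prop) (by fun_prop), hm,
      integral_withDensity_eq_integral_toReal_smul₀ hU.1.aemeasurable.ennreal_ofReal
      (ae_of_all _ fun x => ENNReal.ofReal_lt_top)]
    refine setIntegral_congr_fun measurableSet_Ioi fun x hx => ?_
    simp only [ENNReal.toReal_ofReal (hpos hU0 x), Real.coe_toNNReal x (le_of_lt hx), smul_eq_mul]
    rw [← Real.exp_nat_mul, mul_right_comm, ← Real.exp_add]
    ring_nf
  -- The measure lives on `(0, ∞)`, so passing to `NNReal`, where `e^{-x}` is bounded, loses
  -- nothing.
  have hback : ∀ U : ℝ → ℝ, ((m U).map Real.toNNReal).map ((↑) : NNReal → ℝ) = m U := fun U => by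
    rw [Measure.map_map (by fun_prop) (by fun_prop)]
    have hae : ∀ᵐ x ∂m U, (((↑) : NNReal → ℝ) ∘ Real.toNNReal) x = id x := by
      refine (withDensity_absolutelyContinuous _ _).ae_le ?_
      filter_upwards [ae_restrict_mem measurableSet_Ioi] with x hx
      exact Real.coe_toNNReal x (le_of_lt hx)
    rw [Measure.map_congr hae, Measure.map_id]
  have := hfin hV
  have := hfin hW
  have heq : m V = m W := by
    rw [← hback V, ← hback W, ext_of_integral_exp_neg_nat (P := (m V).map Real.toNNReal)
      (P' := (m W).map Real.toNNReal) fun n => by rw [hint hV0 hV, hint hW0 hW, h n]]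
  rw [hm, withDensity_eq_iff hV.1.aemeasurable.ennreal_ofReal hW.1.aemeasurable.ennreal_ofReal
    (Integrable.lintegral_lt_top hV).ne] at heq
  rw [← ae_restrict_iff' measurableSet_Ioi]
  filter_upwards [heq] with x hx
  rw [ENNReal.ofReal_eq_ofReal_iff (hpos hV0 x) (hpos hW0 x)] at hx
  exact mul_left_cancel₀ (Real.exp_pos _).ne' hx

/-- A null set contains no interval `(x, b)`, so `V` and `W` agree at points arbitrarily close to
`x` from the right. -/
theorem eq_of_ae_eq_of_rightContinuous {V W : ℝ → ℝ} {a x : ℝ} (hx : a ≤ x)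
    (h : ∀ᵐ y, y ∈ Ioi a → V y = W y) (hV : ContinuousWithinAt V (Ici x) x)
    (hW : ContinuousWithinAt W (Ici x) x) : V x = W x := by
  have hf : ∃ᶠ y in 𝓝[>] x, V y = W y := by
    intro hn
    obtain ⟨b, hb, hsub⟩ := mem_nhdsGT_iff_exists_Ioo_subset.1 hn
    have h0 : volume (Ioo x b) = 0 := by
      refine measure_mono_null (fun y hy => ?_) (ae_iff.1 h)
      intro hc
      exact hsub hy (hc (hx.trans_lt hy.1))
    rw [Real.volume_Ioo, ENNReal.ofReal_eq_zero] at h0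
    have : x < b := hb
    linarith
  exact tendsto_nhds_unique_of_frequently_eq
    (hV.mono_left (nhdsWithin_mono x Ioi_subset_Ici_self))
    (hW.mono_left (nhdsWithin_mono x Ioi_subset_Ici_self)) hf

theorem IsScaleFunction.unique {ψ : ℝ → ℝ} {q : ℝ} {V W : ℝ → ℝ} (hV : IsScaleFunction ψ q V)
    (hW : IsScaleFunction ψ q W) : V = W := by
  funext x
  rcases lt_or_ge x 0 with hx | hx
  · rw [hV.eq_zero x hx, hW.eq_zero x hx]
  · have ht : ∀ n : ℕ, largestRoot ψ q < largestRoot ψ q + 1 + n := fun n => by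
      have : (0 : ℝ) ≤ n := n.cast_nonneg
      linarith
    refine eq_of_ae_eq_of_rightContinuous hx (ae_eq_of_laplace_eq hV.nonneg hW.nonneg
      (hV.integrable _ (lt_add_one _)) (hW.integrable _ (lt_add_one _)) fun n => ?_)
      (hV.right_continuous x hx) (hW.right_continuous x hx)
    rw [hV.laplace _ (ht n), hW.laplace _ (ht n)]

/-! ### The transformed scale function -/

theorem integrableOn_exp_mul_Icc {W : ℝ → ℝ} {r : ℝ}
    (hW : IntegrableOn (fun x => Real.exp (-r * x) * W x) (Ioi 0)) (δ b : ℝ) :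
    IntegrableOn (fun y => Real.exp (-δ * y) * W y) (Icc 0 b) := by
  have h1 : IntegrableOn (fun x => Real.exp (-r * x) * W x) (Icc 0 b) :=
    (integrableOn_Icc_iff_integrableOn_Ioc (by simp)).2 (hW.mono_set Ioc_subset_Ioi_self)
  have h2 : ContinuousOn (fun x : ℝ => Real.exp ((r - δ) * x)) (Icc 0 b) := by fun_prop
  refine (h1.continuousOn_mul h2 isCompact_Icc).congr (ae_of_all _ fun y => ?_)
  simp only
  rw [← mul_assoc, ← Real.exp_add]
  ring_nf

/-- The Laplace transform of `x ↦ e^{δ x} ∫_0^x e^{-δ y} W(y) dy`. -/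
theorem laplace_exp_mul_integral {W : ℝ → ℝ} {s δ : ℝ} (hs : 0 < s)
    (hW : IntegrableOn (fun x => Real.exp (-(s + δ) * x) * W x) (Ioi 0)) :
    IntegrableOn (fun x => Real.exp (-s * x) * ∫ y in (0 : ℝ)..x, Real.exp (-δ * y) * W y)
      (Ioi 0) ∧
    ∫ x in Ioi (0 : ℝ), Real.exp (-s * x) * (∫ y in (0 : ℝ)..x, Real.exp (-δ * y) * W y) =
      1 / s * ∫ x in Ioi (0 : ℝ), Real.exp (-(s + δ) * x) * W x := by
  have hg : IntegrableOn (fun x : ℝ => Real.exp (-s * x)) (Ioi 0) :=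
    integrableOn_exp_mul_Ioi (neg_lt_zero.2 hs) 0
  -- The function is the convolution of `e^{-(s+δ)y} W(y)` with `e^{-sy}`.
  have hconv : ∀ x : ℝ, ∫ y in (0 : ℝ)..x, ContinuousLinearMap.mul ℝ ℝ
      (Real.exp (-(s + δ) * y) * W y) (Real.exp (-s * (x - y))) =
      Real.exp (-s * x) * ∫ y in (0 : ℝ)..x, Real.exp (-δ * y) * W y := fun x => by
    rw [← intervalIntegral.integral_const_mul]
    refine intervalIntegral.integral_congr fun y _ => ?_
    simp only [ContinuousLinearMap.mul_apply']
    rw [mul_right_comm, ← Real.exp_add, ← mul_assoc, ← Real.exp_add]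
    ring_nf
  constructor
  · have h := integrable_posConvolution hW hg (ContinuousLinearMap.mul ℝ ℝ)
    rw [posConvolution, integrable_indicator_iff measurableSet_Ioi] at h
    exact h.congr (ae_of_all _ hconv)
  · have h := integral_posConvolution hW hg (ContinuousLinearMap.mul ℝ ℝ)
    simp only [hconv] at h
    rw [h, integral_exp_mul_Ioi (neg_lt_zero.2 hs), ContinuousLinearMap.mul_apply']
    simp [mul_comm]

/-- The scale function of the transformed exponent. -/
noncomputable def transformedScale (δ β : ℝ) (W : ℝ → ℝ) (x : ℝ) : ℝ :=
  Real.exp (-β * x) * (W x + δ * Real.exp (δ * x) * ∫ y in (0 : ℝ)..x, Real.exp (-δ * y) * W y)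

/-- Without the constant term, `δ - β` and `Φ(q) - β` are roots of the transform. Whenever
nonnegative they lie below its largest root, so all Laplace transforms used at `t` converge. -/
theorem lt_of_largestRoot_expTransform_lt {ψ : ℝ → ℝ} (hψ : IsLaplaceExponent ψ) {q δ β : ℝ}
    (hq : 0 ≤ q) (hT : IsLaplaceExponent (expTransform δ β (killedExponent ψ q)))
    (h0 : (β - δ) / β * killedExponent ψ q β = 0) {t : ℝ}
    (ht : largestRoot (expTransform δ β (killedExponent ψ q)) 0 < t) :
    0 < t ∧ δ < t + β ∧ largestRoot ψ q < t + β := by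
  have h1 : 0 < t := (hT.le_largestRoot le_rfl (expTransform_zero _ _ _)).trans_lt ht
  have key : ∀ s : ℝ, expTransform δ β (killedExponent ψ q) (s - β) = 0 → s < t + β := by
    intro s hs
    by_contra! hc
    have := hT.le_largestRoot (by linarith) hs
    linarith
  refine ⟨h1, key δ ?_, key _ ?_⟩
  · simp [expTransform, h0]
  · rw [expTransform, h0, sub_add_cancel, killedExponent, (hψ.largestRoot_mem hq).2]
    simp

theorem IsScaleFunction.transformedScale {ψ : ℝ → ℝ} (hψ : IsLaplaceExponent ψ) {q δ β : ℝ}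
    (hq : 0 ≤ q) (hδ : 0 ≤ δ) (hT : IsLaplaceExponent (expTransform δ β (killedExponent ψ q)))
    (h0 : (β - δ) / β * killedExponent ψ q β = 0) (hβ : 0 ≤ β) {W : ℝ → ℝ}
    (hW : IsScaleFunction ψ q W) :
    IsScaleFunction (expTransform δ β (killedExponent ψ q)) 0 (transformedScale δ β W) := by
  have hloc := fun b => integrableOn_exp_mul_Icc (hW.integrable _ (lt_add_one _)) δ b
  have hnn : ∀ y, 0 ≤ Real.exp (-δ * y) * W y := fun y =>
    mul_nonneg (Real.exp_pos _).le (hW.nonneg y)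
  have hzero : ∀ x, x < 0 → _root_.transformedScale δ β W x = 0 := by
    intro x hx
    have : ∫ y in (0 : ℝ)..x, Real.exp (-δ * y) * W y = 0 := by
      rw [intervalIntegral.integral_of_ge hx.le, integral_Ioc_eq_integral_Ioo,
        setIntegral_eq_zero_of_forall_eq_zero, neg_zero]
      intro y hy
      rw [hW.eq_zero y hy.2, mul_zero]
    rw [_root_.transformedScale, this, hW.eq_zero x hx]
    simp
  have hexp : ∀ t x : ℝ, Real.exp (-t * x) * _root_.transformedScale δ β W x =
      Real.exp (-(t + β) * x) * W x + δ * (Real.exp (-(t + β - δ) * x) *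
        ∫ y in (0 : ℝ)..x, Real.exp (-δ * y) * W y) := fun t x => by
    have e1 : Real.exp (-(t + β) * x) = Real.exp (-t * x) * Real.exp (-β * x) := by
      rw [← Real.exp_add]
      ring_nf
    have e2 : Real.exp (-(t + β - δ) * x) =
        Real.exp (-t * x) * Real.exp (-β * x) * Real.exp (δ * x) := by
      rw [← Real.exp_add, ← Real.exp_add]
      ring_nf
    rw [e1, e2, _root_.transformedScale]
    ring
  have hlap : ∀ t, largestRoot (expTransform δ β (killedExponent ψ q)) 0 < t →
      IntegrableOn (fun x => Real.exp (-t * x) * _root_.transformedScale δ β W x) (Ioi 0) ∧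
      ∫ x in Ioi (0 : ℝ), Real.exp (-t * x) * _root_.transformedScale δ β W x =
        1 / (expTransform δ β (killedExponent ψ q) t - 0) := by
    intro t ht
    obtain ⟨ht0, htδ, htΦ⟩ := lt_of_largestRoot_expTransform_lt hψ hq hT h0 ht
    have hs : 0 < t + β - δ := by linarith
    have hWi := hW.integrable _ htΦ
    have hWl := hW.laplace _ htΦ
    obtain ⟨hi, hl⟩ := laplace_exp_mul_integral (W := W) (δ := δ) hs
      (by rwa [sub_add_cancel])
    rw [sub_add_cancel, hWl] at hl
    simp only [hexp]
    refine ⟨hWi.add (hi.const_mul δ), ?_⟩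
    rw [integral_add hWi (hi.const_mul δ), integral_const_mul, hl, hWl, expTransform, h0,
      killedExponent]
    have : t + β ≠ 0 := by linarith
    rw [sub_zero, sub_zero, one_div_mul_one_div, one_div, one_div, one_div, mul_inv, mul_inv,
      inv_div]
    field_simp
    ring
  refine ⟨fun x => ?_, hzero, fun x hx => ?_, fun t ht => (hlap t ht).1, fun t ht => (hlap t ht).2⟩
  · rcases lt_or_ge x 0 with hx | hx
    · exact (hzero x hx).ge
    · have h1 : 0 ≤ ∫ y in (0 : ℝ)..x, Real.exp (-δ * y) * W y :=
        intervalIntegral.integral_nonneg hx fun y _ => hnn y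
      have h2 := hW.nonneg x
      unfold _root_.transformedScale
      positivity
  · have h1 : ContinuousOn (fun x => ∫ y in (0 : ℝ)..x, Real.exp (-δ * y) * W y)
        (uIcc 0 (x + 1)) := by
      refine intervalIntegral.continuousOn_primitive_interval ?_
      rw [uIcc_of_le (by linarith)]
      exact hloc _
    have h2 : ContinuousWithinAt (fun x => ∫ y in (0 : ℝ)..x, Real.exp (-δ * y) * W y)
        (Ici x) x := by
      rw [uIcc_of_le (by linarith)] at h1
      refine (h1 x ⟨hx, by linarith⟩).mono_of_mem_nhdsWithin ?_
      filter_upwards [self_mem_nhdsWithin,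
        mem_nhdsWithin_of_mem_nhds (Iio_mem_nhds (lt_add_one x))] with y hy hy'
      exact ⟨hx.trans hy, le_of_lt hy'⟩
    have h3 := hW.right_continuous x hx
    unfold _root_.transformedScale
    fun_prop

theorem isScaleFunction_expTransform_iff {ψ : ℝ → ℝ} (hψ : IsLaplaceExponent ψ) {q δ β : ℝ}
    (hq : 0 ≤ q) (hδ : 0 ≤ δ) (hT : IsLaplaceExponent (expTransform δ β (killedExponent ψ q)))
    (h0 : (β - δ) / β * killedExponent ψ q β = 0) (hβ : 0 ≤ β) {W : ℝ → ℝ}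
    (hW : IsScaleFunction ψ q W) (V : ℝ → ℝ) :
    IsScaleFunction (expTransform δ β (killedExponent ψ q)) 0 V ↔
      ∀ x, V x = transformedScale δ β W x := by
  have h := hW.transformedScale hψ hq hδ hT h0 hβ
  refine ⟨fun hV x => congrFun (hV.unique h) x, fun hV => ?_⟩
  rwa [funext hV]

theorem transformedScale_self (β : ℝ) (W : ℝ → ℝ) (x : ℝ) :
    transformedScale β β W x =
      Real.exp (-β * x) * W x + β * ∫ y in (0 : ℝ)..x, Real.exp (-β * y) * W y := by
  have : Real.exp (-β * x) * Real.exp (β * x) = 1 := by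
    rw [← Real.exp_add]
    simp
  rw [transformedScale]
  linear_combination (β * ∫ y in (0 : ℝ)..x, Real.exp (-β * y) * W y) * this

theorem mainTheorem11 (ψ : ℝ → ℝ) (hψ : IsLaplaceExponent ψ) (q : ℝ) (hq : 0 ≤ q)
    (W : ℝ → ℝ) (hW : IsScaleFunction ψ q W) :
    (∀ β : ℝ, 0 ≤ β → (β = 0 → HasRightDerivAtZero ψ 0 ∧ q = 0) →
      IsLaplaceExponent (expTransform β β (killedExponent ψ q)) ∧
      ∀ V : ℝ → ℝ, IsScaleFunction (expTransform β β (killedExponent ψ q)) 0 V ↔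
        ∀ x : ℝ, V x = Real.exp (-β * x) * W x +
          β * ∫ y in (0 : ℝ)..x, Real.exp (-β * y) * W y) ∧
    (∀ m : EReal, HasRightDerivAtZero ψ m → m ≤ 0 → ∀ δ : ℝ, 0 ≤ δ →
      IsLaplaceExponent (expTransform δ (largestRoot ψ q) (killedExponent ψ q)) ∧
      ∀ V : ℝ → ℝ,
        IsScaleFunction (expTransform δ (largestRoot ψ q) (killedExponent ψ q)) 0 V ↔
        ∀ x : ℝ, V x = Real.exp (-largestRoot ψ q * x) *
          (W x + δ * Real.exp (δ * x) * ∫ y in (0 : ℝ)..x, Real.exp (-δ * y) * W y)) := by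
  refine ⟨fun β hβ h0 => ?_, fun m hm hm0 δ hδ => ?_⟩
  · have hT := hψ.expTransform hq hβ hβ h0
    refine ⟨hT, fun V => ?_⟩
    simp only [← transformedScale_self]
    exact isScaleFunction_expTransform_iff hψ hq hβ hT (by simp) hβ hW V
  · obtain ⟨hΦ, hΦq⟩ := hψ.largestRoot_mem hq
    -- `Φ(q) = 0` forces `q = ψ(0) = 0`, and then `ψ'(0+) = 0` since 0 is the largest root.
    have hT := hψ.expTransform hq hδ hΦ fun h => by
      rw [h, hψ.map_zero] at hΦq
      subst hΦq
      exact ⟨hψ.hasRightDerivAtZero_of_largestRoot hm hm0 h, rfl⟩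
    exact ⟨hT, isScaleFunction_expTransform_iff hψ hq hδ hT
      (by simp [killedExponent, hΦq]) hΦ hW⟩
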